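/- Let $E$ be a real Hilbert space, let $r>0$ and put $B_r=\{x\in E:\|x\|\le r\}$. Let $P:E\to\mathbb R$ be a $C^1$ even functional with $P(0)=0$ and $$\limsup_{x\to 0}\frac{P(x)}{\|x\|^2}=+\infty ,$$ and let $\sigma>0$ be such that the restriction to $B_r$ of the functional $x\mapsto \sigma\|x\|^2-P(x)$ is sequentially weakly lower semicontinuous. Derivatives $P'(x)$ of functionals on $E$ are regarded as elements of $E$ (gradients, via the Riesz representation). Then, for each $M\ge 0$ and each $\lambda$ satisfying $$0<\lambda\le\min\left\{\frac{r}{\sup_{x\in B_r}\|x+P'(x)\|+M},\ \frac1{2\sigma}\right\}$$ (the first quotient being $0$ if the supremum is $+\infty$), there exists $\delta^*>0$ with the following property: for each convex set $S\subseteq B_r$ which is dense in $B_r$, and for each $C^1$ functional $\gamma:E\to\mathbb R$ satisfying $$\sup_{B_r}\gamma-\inf_{B_r}\gamma<\delta^*,\qquad \sup_{x\in B_r}\|\gamma'(x)\|\le M,$$ and such that the restriction to $B_r$ of the functional $x\mapsto\sigma\|x\|^2-P(x)-\gamma(x)$ is sequentially weakly lower semicontinuous, there exists $\tilde y\in S$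 with $\|\tilde y\|<r$ such that the equation $$x=\lambda\bigl(P'(x)+\gamma'(x)+\tilde y\bigr)$$ has at least two distinct solutions lying in $B_r$. -/

import Mathlib

open Filter Topology Metric

/-- Sequential weak lower semicontinuity of (the restriction to `s` of) a functional `f`:
whenever points `u n` of `s` converge weakly to a point `x` of `s`, one has
`f x ≤ liminf f (u n)` (the lower limit being taken in the extended reals). -/
def SeqWeakLSCOn {E : Type*} [NormedAddCommGroup E] [NormedSpace ℝ E]
    (f : E → ℝ) (s : Set E) : Prop :=
  ∀ (u : ℕ → E) (x : E), (∀ n, u n ∈ s) → x ∈ s →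
    Tendsto (fun n => toWeakSpace ℝ E (u n)) atTop (𝓝 (toWeakSpace ℝ E x)) →
      (f x : EReal) ≤ liminf (fun n => (f (u n) : EReal)) atTop

/-!
Put `J x = ‖x‖² / (2λ) - P x - γ x` and `f (x, y) = J x - ⟪x, y⟫` for `x` in the closed ball `B` of
radius `r` and `y ∈ S` with `‖y‖ < r`. The critical points of `f (·, y)` are the solutions of the
equation, so it is enough that, for some `y`, the functional `f (·, y)` has two minimizers over `B`,
and that these are critical points.

The second point is `eq_smul_gradient_add_of_isMinOn`: by the bound on `λ`, the
functional decreases from each point of the sphere towards the origin, so minimizers are interior.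

The first point is a minimax argument. Since `λ ≤ 1 / (2σ)`, all `f (·, y)` are sequentially weakly
lower semicontinuous. For `γ = 0`, evenness of `P` and the growth of `P` at the origin make the
minimax inequality for `f` strict, with a gap `δ` that depends on `P`, `r` and `λ` only
(`exists_minimax_gap`). A perturbation `γ` of oscillation less than `δ` leaves it strict. A strict
inequality forces two minimizers for some `y` (`exists_two_isMinOn_sub_inner`): if all minimizers
were unique, a maximizer `y₀` of the concave function `y ↦ min f (·, y)` on the convex hull of
finitely many `y` would give a saddle point. Passing to finitely many `y` takes a compactness
argument for sequentially weakly closed sets, `exists_finset_forall_exists_lt`.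
-/

/-! ### Weak sequential convergence and lower semicontinuity in a Hilbert space -/

theorem tendsto_toWeakSpace_iff_inner {E : Type*} [NormedAddCommGroup E] [InnerProductSpace ℝ E]
    [CompleteSpace E] {u : ℕ → E} {x : E} :
    Tendsto (fun n => toWeakSpace ℝ E (u n)) atTop (𝓝 (toWeakSpace ℝ E x)) ↔
      ∀ v : E, Tendsto (fun n => inner ℝ (u n) v) atTop (𝓝 (inner ℝ x v)) := by
  have hinj : Function.Injective (topDualPairing ℝ E).flip := by
    intro a b hab
    apply ext_inner_left ℝ
    intro v
    exact congrArg (fun l => l (InnerProductSpace.toDual ℝ E v)) hab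
  refine (WeakBilin.tendsto_iff_forall_eval_tendsto (topDualPairing ℝ E).flip hinj).trans ?_
  constructor
  · intro h v
    have := h (InnerProductSpace.toDual ℝ E v)
    simp only [real_inner_comm v]
    exact this
  · intro h l
    obtain ⟨v, rfl⟩ := (InnerProductSpace.toDual ℝ E).surjective l
    have := h v
    simp only [real_inner_comm v] at this
    exact this

/-- Bounded sequences in a real Hilbert space have weakly convergent subsequences. The sequence
lives in the separable closed span of its range, where the sequential Banach–Alaoglu theorem
applies; orthogonal projection carries the convergence back to the whole space. -/
theorem exists_subseq_tendsto_inner {E : Type*} [NormedAddCommGroup E] [InnerProductSpace ℝ E]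
    [CompleteSpace E] {r : ℝ} {u : ℕ → E} (hu : ∀ n, u n ∈ closedBall (0 : E) r) :
    ∃ x ∈ closedBall (0 : E) r, ∃ φ : ℕ → ℕ, StrictMono φ ∧
      ∀ v : E, Tendsto (fun n => inner ℝ (u (φ n)) v) atTop (𝓝 (inner ℝ x v)) := by
  let K : Submodule ℝ E := (Submodule.span ℝ (Set.range u)).topologicalClosure
  have hKc : IsClosed (K : Set E) := Submodule.isClosed_topologicalClosure _
  have : CompleteSpace K := hKc.completeSpace_coe
  have : TopologicalSpace.SeparableSpace K := by
    have h1 : TopologicalSpace.IsSeparable (K : Set E) := by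
      have := ((Set.countable_range u).isSeparable).span (R := ℝ)
      exact this.closure
    exact h1.separableSpace
  have huK : ∀ n, u n ∈ K := fun n =>
    Submodule.le_topologicalClosure _ (Submodule.subset_span ⟨n, rfl⟩)
  let w : ℕ → WeakDual ℝ K := fun n =>
    StrongDual.toWeakDual (InnerProductSpace.toDual ℝ K ⟨u n, huK n⟩)
  have hw : ∀ n, w n ∈ WeakDual.toStrongDual ⁻¹' closedBall (0 : StrongDual ℝ K) r := by
    intro n
    have h1 := hu n
    rw [mem_closedBall_zero_iff] at h1
    change InnerProductSpace.toDual ℝ K ⟨u n, huK n⟩ ∈ closedBall _ r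
    rw [mem_closedBall_zero_iff, LinearIsometryEquiv.norm_map]
    exact h1
  obtain ⟨l, hl, φ, hφ, hlim⟩ := WeakDual.isSeqCompact_closedBall ℝ K 0 r hw
  obtain ⟨z, hz⟩ := (InnerProductSpace.toDual ℝ K).surjective (WeakDual.toStrongDual l)
  refine ⟨z, ?_, φ, hφ, fun v => ?_⟩
  · have h1 : WeakDual.toStrongDual l ∈ closedBall (0 : StrongDual ℝ K) r := hl
    rw [← hz, mem_closedBall_zero_iff, LinearIsometryEquiv.norm_map] at h1
    rw [mem_closedBall_zero_iff]
    exact h1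
  · have h2 := ((WeakDual.eval_continuous (K.orthogonalProjectionOnto v)).tendsto l).comp hlim
    have h3 : l (K.orthogonalProjectionOnto v) = inner ℝ (z : E) v := by
      have : l (K.orthogonalProjectionOnto v)
          = InnerProductSpace.toDual ℝ K z (K.orthogonalProjectionOnto v) := by rw [hz]; rfl
      rw [this, InnerProductSpace.toDual_apply_apply]
      exact Submodule.inner_orthogonalProjectionOnto_eq_of_mem_left z v
    have h4 : ∀ n, w (φ n) (K.orthogonalProjectionOnto v) = inner ℝ (u (φ n)) v := by
      intro n
      have : w (φ n) (K.orthogonalProjectionOnto v)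
          = InnerProductSpace.toDual ℝ K ⟨u (φ n), huK _⟩ (K.orthogonalProjectionOnto v) := rfl
      rw [this, InnerProductSpace.toDual_apply_apply]
      exact Submodule.inner_orthogonalProjectionOnto_eq_of_mem_left (⟨u (φ n), huK _⟩ : K) v
    rw [h3] at h2
    exact h2.congr h4

theorem seqWeakLSCOn_iff_eventually_lt {E : Type*} [NormedAddCommGroup E] [InnerProductSpace ℝ E]
    [CompleteSpace E] {f : E → ℝ} {s : Set E} :
    SeqWeakLSCOn f s ↔ ∀ (u : ℕ → E) (x : E), (∀ n, u n ∈ s) → x ∈ s →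
      (∀ v : E, Tendsto (fun n => inner ℝ (u n) v) atTop (𝓝 (inner ℝ x v))) →
        ∀ c < f x, ∀ᶠ n in atTop, c < f (u n) := by
  refine forall₂_congr fun u x => forall₂_congr fun _ _ => ?_
  rw [tendsto_toWeakSpace_iff_inner, le_liminf_iff]
  refine forall_congr' fun _ => ⟨fun h c hc => ?_, fun h c hc => ?_⟩
  · exact (h c (EReal.coe_lt_coe_iff.2 hc)).mono fun n hn => EReal.coe_lt_coe_iff.1 hn
  · obtain ⟨q, hq1, hq2⟩ := EReal.lt_iff_exists_real_btwn.1 hc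
    exact (h q (EReal.coe_lt_coe_iff.1 hq2)).mono
      fun n hn => hq1.trans (EReal.coe_lt_coe_iff.2 hn)

namespace SeqWeakLSCOn

variable {E : Type*} [NormedAddCommGroup E] [InnerProductSpace ℝ E] [CompleteSpace E]
  {f g : E → ℝ} {s : Set E} {r : ℝ}

theorem add (hf : SeqWeakLSCOn f s) (hg : SeqWeakLSCOn g s) :
    SeqWeakLSCOn (fun x => f x + g x) s := by
  rw [seqWeakLSCOn_iff_eventually_lt] at *
  intro u x hu hx h c hc
  filter_upwards [hf u x hu hx h (f x - (f x + g x - c) / 2) (by linarith),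
    hg u x hu hx h (g x - (f x + g x - c) / 2) (by linarith)] with n h1 h2
  linarith

theorem const_mul_norm_sq {a : ℝ} (ha : 0 ≤ a) (s : Set E) :
    SeqWeakLSCOn (fun x => a * ‖x‖ ^ 2) s := by
  rw [seqWeakLSCOn_iff_eventually_lt]
  intro u x hu hx h c hc
  have h1 : Tendsto (fun n => a * (2 * inner ℝ (u n) x - ‖x‖ ^ 2)) atTop
      (𝓝 (a * (2 * inner ℝ x x - ‖x‖ ^ 2))) :=
    (((h x).const_mul 2).sub_const _).const_mul a
  rw [real_inner_self_eq_norm_sq] at h1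
  filter_upwards [h1.eventually (lt_mem_nhds (show c < _ by linarith))] with n hn
  refine hn.trans_le (mul_le_mul_of_nonneg_left ?_ ha)
  have := sq_nonneg ‖u n - x‖
  rw [norm_sub_sq_real] at this
  linarith

theorem neg_inner (y : E) (s : Set E) : SeqWeakLSCOn (fun x => - inner ℝ x y) s := by
  rw [seqWeakLSCOn_iff_eventually_lt]
  intro u x hu hx h c hc
  exact (h y).neg.eventually (lt_mem_nhds hc)

theorem sub_inner (hf : SeqWeakLSCOn f s) (y : E) :
    SeqWeakLSCOn (fun x => f x - inner ℝ x y) s := by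
  simpa only [sub_eq_add_neg] using hf.add (neg_inner y s)

theorem le_of_tendsto (hf : SeqWeakLSCOn f s) {u : ℕ → E} {x : E} (hu : ∀ n, u n ∈ s)
    (hx : x ∈ s) (h : ∀ v : E, Tendsto (fun n => inner ℝ (u n) v) atTop (𝓝 (inner ℝ x v)))
    {a : ℕ → ℝ} {b : ℝ} (hle : ∀ᶠ n in atTop, f (u n) ≤ a n) (ha : Tendsto a atTop (𝓝 b)) :
    f x ≤ b := by
  rw [seqWeakLSCOn_iff_eventually_lt] at hf
  refine le_of_forall_lt fun c hc => ?_
  obtain ⟨c', hc', hc''⟩ := exists_between hc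
  have := hf u x hu hx h c' hc''
  refine hc'.trans_le (ge_of_tendsto ha ?_)
  filter_upwards [this, hle] with n h1 h2 using h1.le.trans h2

/-- The direct method: a sequentially weakly lower semicontinuous functional attains its minimum
on a closed ball; boundedness below comes from the same compactness as attainment. -/
theorem exists_isMinOn (hr : 0 ≤ r) (hf : SeqWeakLSCOn f (closedBall 0 r)) :
    ∃ x ∈ closedBall (0 : E) r, IsMinOn f (closedBall 0 r) x := by
  have hne : (f '' closedBall (0 : E) r).Nonempty := ⟨_, 0, by simpa using hr, rfl⟩
  have hbdd : BddBelow (f '' closedBall (0 : E) r) := by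
    by_contra hb
    have h1 : ∀ n : ℕ, ∃ x ∈ closedBall (0 : E) r, f x ≤ -n := by
      intro n
      by_contra! h
      refine hb ⟨-n, ?_⟩
      rintro _ ⟨x, hx, rfl⟩
      exact (h x hx).le
    choose u hu hfu using h1
    obtain ⟨x, hx, φ, hφ, hlim⟩ := exists_subseq_tendsto_inner hu
    rw [seqWeakLSCOn_iff_eventually_lt] at hf
    have h2 := hf (u ∘ φ) x (fun n => hu _) hx hlim (f x - 1) (by linarith)
    obtain ⟨N, hN⟩ := exists_nat_gt (1 - f x)
    obtain ⟨n, hn1, hn2⟩ := (h2.and (eventually_ge_atTop N)).exists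
    have h3 := hfu (φ n)
    have h4 : (N : ℝ) ≤ φ n := by exact_mod_cast hn2.trans (hφ.le_apply)
    simp only [Function.comp] at hn1
    linarith
  obtain ⟨a, -, ha, hmem⟩ := exists_seq_tendsto_sInf hne hbdd
  choose u hu hfu using hmem
  obtain ⟨x, hx, φ, hφ, hlim⟩ := exists_subseq_tendsto_inner hu
  refine ⟨x, hx, fun y hy => ?_⟩
  have : f x ≤ sInf (f '' closedBall (0 : E) r) :=
    hf.le_of_tendsto (u := u ∘ φ) (fun n => hu _) hx hlim
      (Eventually.of_forall fun n => (hfu _).le) (ha.comp hφ.tendsto_atTop)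
  exact this.trans (csInf_le hbdd ⟨y, hy, rfl⟩)

end SeqWeakLSCOn

/-! ### Minimax inequalities and multiple minimizers -/

/-- A compactness principle for the sublevel sets `{x | J x - ⟪x, y⟫ ≤ c}`, `y ∈ T`, in the ball.
These sets are only sequentially weakly closed, so the finite intersection property of weakly
compact sets is not directly available. Instead, assuming that all finite intersections are
nonempty, an increasing sequence of finite index sets is chosen along which the distance from the
origin to the intersection tends to its supremum over all finite index sets. Almost nearest points
then have a weak limit whose norm is the limit of the norms, so they converge in norm. -/
theorem exists_finset_forall_exists_lt {E : Type*} [NormedAddCommGroup E] [InnerProductSpace ℝ E]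
    [CompleteSpace E] {r R c c' : ℝ} {J : E → ℝ} {T : Set E}
    (hJc : Continuous J) (hJ : SeqWeakLSCOn J (closedBall 0 r)) (hTR : T ⊆ closedBall 0 R)
    (hcc' : c < c') (h : ∀ x ∈ closedBall (0 : E) r, ∃ y ∈ T, c' < J x - inner ℝ x y) :
    ∃ F : Finset E, (F : Set E) ⊆ T ∧
      ∀ x ∈ closedBall (0 : E) r, ∃ y ∈ F, c < J x - inner ℝ x y := by
  classical
  by_contra! hcon
  let A : Finset T → Set E := fun F =>
    {x | x ∈ closedBall (0 : E) r ∧ ∀ y ∈ F, J x - inner ℝ x (y : E) ≤ c}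
  have hA : ∀ F, (A F).Nonempty := by
    intro F
    obtain ⟨x, hx, hxF⟩ := hcon (F.map (Function.Embedding.subtype _)) (by
      intro y hy
      simp only [Finset.coe_map, Set.mem_image] at hy
      obtain ⟨z, -, rfl⟩ := hy
      exact z.2)
    exact ⟨x, hx, fun y hy => hxF y (by simpa using hy)⟩
  have hAmono : ∀ F G, F ⊆ G → A G ⊆ A F := fun F G hFG x hx =>
    ⟨hx.1, fun y hy => hx.2 y (hFG hy)⟩
  let d : Finset T → ℝ := fun F => sInf (norm '' A F)
  have hbelow : ∀ F, BddBelow (norm '' A F) := fun F =>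
    ⟨0, by rintro _ ⟨x, -, rfl⟩; exact norm_nonneg x⟩
  have hd_le : ∀ F, ∀ x ∈ A F, d F ≤ ‖x‖ := fun F x hx => csInf_le (hbelow F) ⟨x, hx, rfl⟩
  have hd_nonneg : ∀ F, 0 ≤ d F := fun F =>
    le_csInf ((hA F).image _) (by rintro _ ⟨x, -, rfl⟩; exact norm_nonneg x)
  have hd_mono : ∀ F G, F ⊆ G → d F ≤ d G := fun F G hFG =>
    csInf_le_csInf (hbelow F) ((hA G).image _) (Set.image_mono (hAmono F G hFG))
  have hsel : ∀ (F : Finset T) (n : ℕ), ∃ x ∈ A F, ‖x‖ < d F + 1 / ((n : ℝ) + 1) := by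
    intro F n
    obtain ⟨_, ⟨x, hx, rfl⟩, hlt⟩ := exists_lt_of_csInf_lt ((hA F).image norm)
      (show sInf (norm '' A F) < d F + 1 / ((n : ℝ) + 1) from
        lt_add_of_pos_right _ (by positivity))
    exact ⟨x, hx, hlt⟩
  choose X hXA hXd using hsel
  have hD : BddAbove (Set.range d) := by
    refine ⟨r, ?_⟩
    rintro _ ⟨F, rfl⟩
    obtain ⟨x, hx⟩ := hA F
    exact (hd_le F x hx).trans (by simpa using hx.1)
  obtain ⟨a, -, ha, hmem⟩ := exists_seq_tendsto_sSup (Set.range_nonempty d) hD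
  choose K hK using hmem
  set s := sSup (Set.range d) with hs
  have hds : ∀ F, d F ≤ s := fun F => le_csSup hD ⟨F, rfl⟩
  have hs0 : 0 ≤ s := (hd_nonneg ∅).trans (hds ∅)
  have hY : ∀ x : closedBall (0 : E) r, ∃ y : T, c' < J x - inner ℝ (x : E) (y : E) := by
    intro x
    obtain ⟨y, hy, hlt⟩ := h x x.2
    exact ⟨⟨y, hy⟩, hlt⟩
  choose Y hY using hY
  -- At each stage the next index set also receives a `y` that excludes the current point.
  let G : ℕ → Finset T := fun n =>
    Nat.rec ∅ (fun n F => insert (Y ⟨X F n, (hXA F n).1⟩) (F ∪ K n)) n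
  have hGsucc : ∀ n, G (n + 1) = insert (Y ⟨X (G n) n, (hXA (G n) n).1⟩) (G n ∪ K n) :=
    fun n => rfl
  have hGmono : Monotone G := monotone_nat_of_le_succ fun n => by
    rw [hGsucc]
    exact Finset.subset_union_left.trans (Finset.subset_insert _ _)
  let x : ℕ → E := fun n => X (G n) n
  have hxA : ∀ m n, m ≤ n → x n ∈ A (G m) := fun m n hmn => hAmono _ _ (hGmono hmn) (hXA _ _)
  have hxB : ∀ n, x n ∈ closedBall (0 : E) r := fun n => (hXA (G n) n).1
  have hdG : Tendsto (fun n => d (G n)) atTop (𝓝 s) := by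
    rw [← tendsto_add_atTop_iff_nat 1]
    refine tendsto_of_tendsto_of_tendsto_of_le_of_le ha tendsto_const_nhds (fun n => ?_)
      (fun n => hds _)
    change a n ≤ d (G (n + 1))
    rw [← hK n]
    refine hd_mono _ _ ?_
    rw [hGsucc]
    exact Finset.subset_union_right.trans (Finset.subset_insert _ _)
  have hxn : Tendsto (fun n => ‖x n‖) atTop (𝓝 s) := by
    have h1 := hdG.add (tendsto_one_div_add_atTop_nhds_zero_nat (𝕜 := ℝ))
    rw [add_zero] at h1
    exact tendsto_of_tendsto_of_tendsto_of_le_of_le hdG h1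
      (fun n => hd_le _ _ (hXA _ _)) (fun n => (hXd _ _).le)
  obtain ⟨z, hz, φ, hφ, hlim⟩ := exists_subseq_tendsto_inner hxB
  have hzA : ∀ m, z ∈ A (G m) := by
    refine fun m => ⟨hz, fun y hy => ?_⟩
    refine (hJ.sub_inner (y : E)).le_of_tendsto (u := x ∘ φ) (fun n => hxB _) hz hlim ?_
      (tendsto_const_nhds (x := c))
    filter_upwards [eventually_ge_atTop m] with n hn
    exact (hxA m (φ n) (hn.trans hφ.le_apply)).2 y hy
  have hsz : s ≤ ‖z‖ := le_of_tendsto' hdG fun m => hd_le _ _ (hzA m)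
  have hstrong : Tendsto (fun n => x (φ n)) atTop (𝓝 z) := by
    have h1 : Tendsto (fun n => ‖x (φ n) - z‖ ^ 2) atTop
        (𝓝 (s ^ 2 - 2 * inner ℝ z z + ‖z‖ ^ 2)) := by
      simp only [norm_sub_sq_real]
      exact (((hxn.comp hφ.tendsto_atTop).pow 2).sub ((hlim z).const_mul 2)).add_const _
    have h2 : s ^ 2 - 2 * inner ℝ z z + ‖z‖ ^ 2 = 0 := by
      have h3 := ge_of_tendsto' h1 fun n => sq_nonneg _
      rw [real_inner_self_eq_norm_sq] at h3 ⊢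
      have := pow_le_pow_left₀ hs0 hsz 2
      linarith
    rw [h2] at h1
    rw [tendsto_iff_norm_sub_tendsto_zero]
    have h4 := h1.sqrt
    simpa using h4
  have hsmall : Tendsto (fun n => J (x (φ n)) - J z + ‖x (φ n) - z‖ * R) atTop (𝓝 0) := by
    have h1 := ((hJc.tendsto z).comp hstrong).sub_const (J z)
    have h2 := (tendsto_iff_norm_sub_tendsto_zero.1 hstrong).mul_const R
    simpa using h1.add h2
  refine absurd (ge_of_tendsto' hsmall (b := c' - c) fun n => ?_) (by linarith)
  let y : T := Y ⟨x (φ n), hxB _⟩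
  have h1 : c' < J (x (φ n)) - inner ℝ (x (φ n)) (y : E) := hY ⟨x (φ n), hxB _⟩
  have h2 : J z - inner ℝ z (y : E) ≤ c :=
    (hzA (φ n + 1)).2 y (by rw [hGsucc]; exact Finset.mem_insert_self _ _)
  have h3 : -inner ℝ (x (φ n) - z) (y : E) ≤ ‖x (φ n) - z‖ * R := by
    have h4 := neg_le_abs (inner ℝ (x (φ n) - z) (y : E))
    have h5 := abs_real_inner_le_norm (x (φ n) - z) (y : E)
    have h6 : ‖(y : E)‖ ≤ R := by simpa using hTR y.2
    exact h4.trans (h5.trans (mul_le_mul_of_nonneg_left h6 (norm_nonneg _)))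
  rw [inner_sub_left] at h3
  linarith

/-- If the minimax inequality for `J x - ⟪x, y⟫` on the ball times a convex set `T` is strict,
then for some `y ∈ T` the minimum over the ball is attained twice. After reduction to the convex
hull of finitely many points, the minimum value, as a function of `y`, has a maximizer `y₀`. Were
all minimizers unique, those at points tending to `y₀` along a segment would have a subsequence
converging weakly to the one at `y₀`, which would show that it satisfies the inequalities for all the finitely many `y`. -/
theorem exists_two_isMinOn_sub_inner {E : Type*} [NormedAddCommGroup E] [InnerProductSpace ℝ E]
    [CompleteSpace E] {r R c c' : ℝ} {J : E → ℝ} {T : Set E} (hr : 0 ≤ r)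
    (hJc : Continuous J) (hJ : SeqWeakLSCOn J (closedBall 0 r)) (hTR : T ⊆ closedBall 0 R)
    (hT : Convex ℝ T) (hcc' : c < c')
    (hlow : ∀ y ∈ T, ∃ x ∈ closedBall (0 : E) r, J x - inner ℝ x y ≤ c)
    (hup : ∀ x ∈ closedBall (0 : E) r, ∃ y ∈ T, c' < J x - inner ℝ x y) :
    ∃ y ∈ T, ∃ x₁ ∈ closedBall (0 : E) r, ∃ x₂ ∈ closedBall (0 : E) r, x₁ ≠ x₂ ∧
      IsMinOn (fun x => J x - inner ℝ x y) (closedBall 0 r) x₁ ∧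
      IsMinOn (fun x => J x - inner ℝ x y) (closedBall 0 r) x₂ := by
  by_contra! hcon
  obtain ⟨F, hFT, hF⟩ := exists_finset_forall_exists_lt hJc hJ hTR hcc' hup
  choose ξ hξB hξ using fun y => (hJ.sub_inner y).exists_isMinOn hr
  have hξle : ∀ y, ∀ x ∈ closedBall (0 : E) r,
      J (ξ y) - inner ℝ (ξ y) y ≤ J x - inner ℝ x y := fun y => isMinOn_iff.1 (hξ y)
  have hnorm : ∀ y, ‖ξ y‖ ≤ r := fun y => by simpa using hξB y
  have hinner : ∀ y v, inner ℝ (ξ y) v ≤ r * ‖v‖ := fun y v =>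
    (real_inner_le_norm _ _).trans (mul_le_mul_of_nonneg_right (hnorm y) (norm_nonneg v))
  let m : E → ℝ := fun y => J (ξ y) - inner ℝ (ξ y) y
  have hm : Continuous m := by
    refine (LipschitzWith.of_le_add_mul ⟨r, hr⟩ fun y y' => ?_).continuous
    have h1 := hξle y (ξ y') (hξB y')
    have h2 := hinner y' (y' - y)
    rw [inner_sub_right] at h2
    rw [dist_comm, dist_eq_norm]
    change J (ξ y) - inner ℝ (ξ y) y ≤ J (ξ y') - inner ℝ (ξ y') y' + r * ‖y' - y‖
    linarith
  have hFne : (convexHull ℝ (F : Set E)).Nonempty := by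
    obtain ⟨y, hy, -⟩ := hF 0 (by simpa using hr)
    exact ⟨y, subset_convexHull ℝ _ hy⟩
  obtain ⟨y₀, hy₀, hmax⟩ :=
    (F.finite_toSet.isCompact_convexHull (𝕜 := ℝ)).exists_isMaxOn hFne hm.continuousOn
  have hy₀T : y₀ ∈ T := convexHull_min hFT hT hy₀
  have hmc : m y₀ ≤ c := by
    obtain ⟨x, hx, hxc⟩ := hlow y₀ hy₀T
    exact (hξle y₀ x hx).trans hxc
  obtain ⟨y, hy, hlt⟩ := hF (ξ y₀) (hξB y₀)
  refine absurd hlt (not_lt.2 (le_trans ?_ hmc))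
  let t : ℕ → ℝ := fun n => 1 / ((n : ℝ) + 1)
  have ht0 : ∀ n, 0 < t n := fun n => by positivity
  have ht1 : ∀ n, t n ≤ 1 := fun n => by
    rw [div_le_one (by positivity)]
    linarith [n.cast_nonneg (α := ℝ)]
  have htlim : Tendsto t atTop (𝓝 0) := tendsto_one_div_add_atTop_nhds_zero_nat
  let v : ℕ → E := fun n => y₀ + t n • (y - y₀)
  have hv : ∀ n, m (v n) ≤ m y₀ := fun n => hmax
    ((convex_convexHull ℝ _).add_smul_sub_mem hy₀ (subset_convexHull ℝ _ hy) ⟨(ht0 n).le, ht1 n⟩)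
  have hexp : ∀ n x, inner ℝ x (v n) = inner ℝ x y₀ + t n * (inner ℝ x y - inner ℝ x y₀) :=
    fun n x => by simp only [v, inner_add_right, inner_smul_right, inner_sub_right]
  have hbound : ∀ n, J (ξ (v n)) - inner ℝ (ξ (v n)) y ≤ m y₀ := by
    intro n
    have h1 : J (ξ (v n)) - inner ℝ (ξ (v n)) (v n) ≤ m y₀ := hv n
    have h2 : m y₀ ≤ J (ξ (v n)) - inner ℝ (ξ (v n)) y₀ := hξle y₀ _ (hξB _)
    rw [hexp] at h1
    have h3 := mul_le_mul_of_nonneg_left h2 (sub_nonneg.2 (ht1 n))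
    have h4 : t n * (J (ξ (v n)) - inner ℝ (ξ (v n)) y) ≤ t n * m y₀ := by linarith
    exact le_of_mul_le_mul_left h4 (ht0 n)
  have hbound₀ : ∀ n, J (ξ (v n)) - inner ℝ (ξ (v n)) y₀ ≤ m y₀ + t n * (r * ‖y - y₀‖) := by
    intro n
    have h1 : J (ξ (v n)) - inner ℝ (ξ (v n)) (v n) ≤ m y₀ := hv n
    rw [hexp, ← inner_sub_right] at h1
    have h2 := mul_le_mul_of_nonneg_left (hinner (v n) (y - y₀)) (ht0 n).le
    linarith
  obtain ⟨z, hz, φ, hφ, hlim⟩ := exists_subseq_tendsto_inner fun n => hξB (v n)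
  have hz1 : J z - inner ℝ z y ≤ m y₀ :=
    (hJ.sub_inner y).le_of_tendsto (u := fun n => ξ (v (φ n))) (fun n => hξB _) hz hlim
      (Eventually.of_forall fun n => hbound _) tendsto_const_nhds
  have hz0 : J z - inner ℝ z y₀ ≤ m y₀ := by
    refine (hJ.sub_inner y₀).le_of_tendsto (u := fun n => ξ (v (φ n))) (fun n => hξB _) hz hlim
      (Eventually.of_forall fun n => hbound₀ _) ?_
    have h1 := ((htlim.comp hφ.tendsto_atTop).mul_const (r * ‖y - y₀‖)).const_add (m y₀)
    simpa using h1
  have hzeq : ξ y₀ = z := by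
    by_contra hne
    exact hcon y₀ hy₀T (ξ y₀) (hξB y₀) z hz hne (hξ y₀)
      (isMinOn_iff.2 fun x hx => hz0.trans (hξle y₀ x hx))
  rw [hzeq]
  exact hz1

/-! ### The minimax gap of an even functional -/

/-- The minimax gap of an even functional `J` with `J 0 = 0` that is negative somewhere on the
ball. Evenness puts the maximum over `y` of `min_x (J x - ⟪x, y⟫)` at `y = 0`, where the value is
`m = min J < 0`; on the other side `J x + r * ‖x‖`, the supremum over `‖y‖ < r`, stays away from
`m`, because `J` is close to `0` near the origin and `r * ‖x‖` is bounded below elsewhere. -/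
theorem exists_minimax_gap {E : Type*} [NormedAddCommGroup E] [InnerProductSpace ℝ E]
    [CompleteSpace E] {r : ℝ} {J : E → ℝ} (hr : 0 < r) (hJc : Continuous J)
    (hJ : SeqWeakLSCOn J (closedBall 0 r)) (heven : Function.Even J) (hJ0 : J 0 = 0)
    (hneg : ∃ x ∈ closedBall (0 : E) r, J x < 0) :
    ∃ m δ : ℝ, 0 < δ ∧ (∀ x ∈ closedBall (0 : E) r, m + δ ≤ J x + r * ‖x‖) ∧
      ∀ y, ∃ x ∈ closedBall (0 : E) r, J x - inner ℝ x y ≤ m := by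
  obtain ⟨x₀, hx₀, hmin⟩ := hJ.exists_isMinOn hr.le
  rw [isMinOn_iff] at hmin
  have hm : J x₀ < 0 := by
    obtain ⟨x, hx, hlt⟩ := hneg
    exact (hmin x hx).trans_lt hlt
  have hnear : ∀ᶠ x in 𝓝 (0 : E), J x₀ / 2 < J x :=
    hJc.continuousAt.eventually (lt_mem_nhds (by rw [hJ0]; linarith))
  obtain ⟨ρ, hρ, hρJ⟩ := Metric.eventually_nhds_iff.1 hnear
  refine ⟨J x₀, min (-J x₀ / 2) (r * ρ), lt_min (by linarith) (by positivity),
    fun x hx => ?_, fun y => ?_⟩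
  · rcases lt_or_ge ‖x‖ ρ with hlt | hge
    · have h1 := hρJ (show dist x 0 < ρ by simpa using hlt)
      have h2 := min_le_left (-J x₀ / 2) (r * ρ)
      have h3 : 0 ≤ r * ‖x‖ := by positivity
      linarith
    · have h1 := hmin x hx
      have h2 := min_le_right (-J x₀ / 2) (r * ρ)
      have h3 := mul_le_mul_of_nonneg_left hge hr.le
      linarith
  · rcases le_total 0 (inner ℝ x₀ y) with h | h
    · exact ⟨x₀, hx₀, by linarith⟩
    · refine ⟨-x₀, by simpa using hx₀, ?_⟩
      rw [heven x₀, inner_neg_left]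
      linarith

/-- The support function of the ball, computed on the points of norm less than `r` of a set that is
dense in the ball. -/
theorem exists_mem_norm_lt_lt_neg_inner {E : Type*} [NormedAddCommGroup E] [InnerProductSpace ℝ E]
    {r a : ℝ} {S : Set E} (hr : 0 < r) (hS : closedBall 0 r ⊆ closure S) {x : E}
    (ha : a < r * ‖x‖) : ∃ y ∈ S, ‖y‖ < r ∧ a < -inner ℝ x y := by
  obtain ⟨s, hs, hsr, has⟩ : ∃ s : ℝ, 0 < s ∧ s < r ∧ a < s * ‖x‖ := by
    have h1 : ∀ᶠ s in 𝓝[<] r, a < s * ‖x‖ :=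
      ((continuous_id.mul continuous_const).continuousWithinAt.eventually (lt_mem_nhds ha))
    have h2 : ∀ᶠ s in 𝓝[<] r, 0 < s := nhdsWithin_le_nhds (lt_mem_nhds hr)
    obtain ⟨s, ⟨h3, h4⟩, h5⟩ := ((h1.and h2).and self_mem_nhdsWithin).exists
    exact ⟨s, h4, h5, h3⟩
  let z : E := -((s / ‖x‖) • x)
  have hzs : ‖z‖ ≤ s := by
    rw [norm_neg, norm_smul, Real.norm_of_nonneg (by positivity)]
    rcases eq_or_ne ‖x‖ 0 with hx | hx
    · simpa [hx] using hs.le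
    · rw [div_mul_cancel₀ _ hx]
  have hza : a < -inner ℝ x z := by
    rw [inner_neg_right, neg_neg, inner_smul_right, real_inner_self_eq_norm_sq]
    rcases eq_or_ne x 0 with rfl | hx
    · simpa using has
    · have : ‖x‖ ≠ 0 := norm_ne_zero_iff.2 hx
      have h3 : s / ‖x‖ * ‖x‖ ^ 2 = s * ‖x‖ := by field_simp
      rwa [h3]
  have hzS : z ∈ closure S := hS (by simpa using hzs.trans hsr.le)
  have hopen : IsOpen {y : E | ‖y‖ < r ∧ a < -inner ℝ x y} :=
    (isOpen_lt continuous_norm continuous_const).inter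
      (isOpen_lt continuous_const (continuous_const.inner (𝕜 := ℝ) continuous_id).neg)
  obtain ⟨y, hy, hyS⟩ := mem_closure_iff.1 hzS _ hopen ⟨hzs.trans_lt hsr, hza⟩
  exact ⟨y, hyS, hy.1, hy.2⟩

/-! ### Minimizers are interior critical points -/

/-- Minimizers over the ball of `‖x‖² / (2λ) - Q x - ⟪x, y⟫` are free critical points when
`‖y‖ < r`. A minimizer `x` on the sphere would satisfy
`r² / λ ≤ ⟪Q' x + y, x⟫ = ⟪x + Q' x, x⟫ - ⟪x - y, x⟫`, where the last term is positive, against the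
bound on `‖x + Q' x‖`. -/
theorem eq_smul_gradient_add_of_isMinOn {E : Type*} [NormedAddCommGroup E]
    [InnerProductSpace ℝ E] [CompleteSpace E] {r lam : ℝ} {Q : E → ℝ} {x y : E} (hlam : 0 < lam)
    (hQ : DifferentiableAt ℝ Q x) (hx : x ∈ closedBall (0 : E) r) (hy : ‖y‖ < r)
    (hbound : lam * ‖x + gradient Q x‖ ≤ r)
    (hmin : IsMinOn (fun x => 1 / (2 * lam) * ‖x‖ ^ 2 - Q x - inner ℝ x y) (closedBall 0 r) x) :
    x = lam • (gradient Q x + y) := by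
  have hr : 0 < r := (norm_nonneg y).trans_lt hy
  have hderiv : HasFDerivAt (fun x => 1 / (2 * lam) * ‖x‖ ^ 2 - Q x - inner ℝ x y)
      (InnerProductSpace.toDual ℝ E (lam⁻¹ • x - gradient Q x - y)) x := by
    have h1 := ((hasFDerivAt_id (𝕜 := ℝ) x).norm_sq.const_mul (1 / (2 * lam))).sub
      hQ.hasGradientAt.hasFDerivAt
    have h2 := h1.sub ((hasFDerivAt_id (𝕜 := ℝ) x).inner ℝ (hasFDerivAt_const y x))
    refine h2.congr_fderiv ?_
    ext v
    simp [real_inner_comm]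
    field_simp
  have hxr : ‖x‖ ≤ r := by simpa using hx
  rcases hxr.lt_or_eq with hlt | heq
  · have hloc := hmin.isLocalMin (closedBall_mem_nhds_of_mem (by simpa using hlt))
    have h0 := hloc.hasFDerivAt_eq_zero hderiv
    rw [LinearIsometryEquiv.map_eq_zero_iff, sub_sub, sub_eq_zero] at h0
    rw [← h0, smul_inv_smul₀ hlam.ne']
  · exfalso
    have hcone : -x ∈ posTangentConeAt (closedBall (0 : E) r) x := by
      refine mem_posTangentConeAt_of_segment_subset ?_
      rw [add_neg_cancel]
      exact (convex_closedBall 0 r).segment_subset hx (by simpa using hr.le)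
    have h0 := hmin.localize.hasFDerivWithinAt_nonneg hderiv.hasFDerivWithinAt hcone
    rw [InnerProductSpace.toDual_apply_apply, inner_neg_right, inner_sub_left, inner_sub_left,
      real_inner_smul_left, real_inner_self_eq_norm_sq, heq] at h0
    have h1 := real_inner_le_norm (x + gradient Q x) x
    rw [inner_add_left, real_inner_self_eq_norm_sq, heq] at h1
    have h2 := real_inner_le_norm y x
    rw [heq] at h2
    have h3 : ‖y‖ * r < r * r := mul_lt_mul_of_pos_right hy hr
    have h4 : lam⁻¹ * r ^ 2 < ‖x + gradient Q x‖ * r := by nlinarith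
    have h5 := mul_lt_mul_of_pos_left h4 hlam
    rw [mul_inv_cancel_left₀ hlam.ne', ← mul_assoc, sq] at h5
    exact absurd (lt_of_mul_lt_mul_right h5 hr.le) (not_lt.2 hbound)

/-! ### Extended-real hypotheses in real terms -/

/-- Real form of the condition `λ ≤ r / (sup ‖x + P' x‖ + M)`. -/
theorem mul_norm_add_le_of_ofReal_le_div {E : Type*} [NormedAddCommGroup E] {r M lam : ℝ}
    {g : E → E} {s : Set E} (hr : 0 ≤ r) (hM : 0 ≤ M) (hlam0 : 0 ≤ lam)
    (hlam : ENNReal.ofReal lam ≤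
      ENNReal.ofReal r / ((⨆ x ∈ s, ENNReal.ofReal ‖g x‖) + ENNReal.ofReal M))
    {x : E} (hx : x ∈ s) : lam * (‖g x‖ + M) ≤ r := by
  rw [← ENNReal.ofReal_le_ofReal_iff hr, ENNReal.ofReal_mul hlam0,
    ENNReal.ofReal_add (norm_nonneg _) hM]
  have h1 := ENNReal.mul_le_of_le_div hlam
  have h2 : ENNReal.ofReal ‖g x‖ ≤ ⨆ x ∈ s, ENNReal.ofReal ‖g x‖ :=
    le_iSup₂ (f := fun x _ => ENNReal.ofReal ‖g x‖) x hx
  exact (mul_le_mul_right (add_le_add_left h2 _) _).trans h1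

/-- A finite oscillation, computed in the extended reals, yields real bounds. -/
theorem exists_bounds_of_iSup_sub_iInf_lt {α : Type*} {γ : α → ℝ} {s : Set α} {δ : ℝ}
    (hs : s.Nonempty)
    (h : (⨆ x ∈ s, (γ x : EReal)) - (⨅ x ∈ s, (γ x : EReal)) < (δ : EReal)) :
    ∃ a b : ℝ, b - a < δ ∧ ∀ x ∈ s, a ≤ γ x ∧ γ x ≤ b := by
  obtain ⟨x₀, hx₀⟩ := hs
  have hsup : ∀ x ∈ s, (γ x : EReal) ≤ ⨆ x ∈ s, (γ x : EReal) := fun x hx =>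
    le_iSup₂ (f := fun x _ => (γ x : EReal)) x hx
  have hinf : ∀ x ∈ s, (⨅ x ∈ s, (γ x : EReal)) ≤ γ x := fun x hx =>
    iInf₂_le (f := fun x _ => (γ x : EReal)) x hx
  generalize (⨆ x ∈ s, (γ x : EReal)) = B at h hsup
  generalize (⨅ x ∈ s, (γ x : EReal)) = A at h hinf
  induction B with
  | bot => exact absurd (hsup x₀ hx₀) (by simp)
  | top =>
    induction A with
    | bot => simp at h
    | top => exact absurd (hinf x₀ hx₀) (by simp)
    | coe a => simp at h
  | coe b =>
    induction A with
    | bot => simp at h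
    | top => exact absurd (hinf x₀ hx₀) (by simp)
    | coe a =>
      exact ⟨a, b, by exact_mod_cast h, fun x hx =>
        ⟨EReal.coe_le_coe_iff.1 (hinf x hx), EReal.coe_le_coe_iff.1 (hsup x hx)⟩⟩

theorem exists_mul_norm_sq_lt_of_limsup_eq_top {E : Type*} [NormedAddCommGroup E] {P : E → ℝ}
    (h : limsup (fun x : E => ((P x / ‖x‖ ^ 2 : ℝ) : EReal)) (𝓝[≠] 0) = ⊤)
    {r : ℝ} (hr : 0 < r) (a : ℝ) : ∃ x ∈ closedBall (0 : E) r, a * ‖x‖ ^ 2 < P x := by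
  have h1 : ∃ᶠ x in 𝓝[≠] (0 : E), (a : EReal) < ((P x / ‖x‖ ^ 2 : ℝ) : EReal) :=
    frequently_lt_of_lt_limsup (by isBoundedDefault) (by rw [h]; exact EReal.coe_lt_top a)
  have h2 : ∀ᶠ x in 𝓝[≠] (0 : E), x ∈ closedBall (0 : E) r :=
    nhdsWithin_le_nhds (closedBall_mem_nhds 0 hr)
  obtain ⟨x, ⟨hx1, hx2⟩, hx3⟩ := ((h1.and_eventually h2).and_eventually self_mem_nhdsWithin).exists
  have hx0 : 0 < ‖x‖ := norm_pos_iff.2 hx3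
  exact ⟨x, hx2, (lt_div_iff₀ (by positivity)).1 (EReal.coe_lt_coe_iff.1 hx1)⟩

/-! ### Two solutions of the perturbed equation -/

theorem theorem2p1 {E : Type*} [NormedAddCommGroup E] [InnerProductSpace ℝ E] [CompleteSpace E]
    (r : ℝ) (hr : 0 < r) (P : E → ℝ) (hP : ContDiff ℝ 1 P) (hPeven : Function.Even P)
    (hP0 : P 0 = 0)
    (hlimsup : limsup (fun x : E => ((P x / ‖x‖ ^ 2 : ℝ) : EReal)) (𝓝[≠] 0) = ⊤)
    (σ : ℝ) (hσ : 0 < σ)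
    (hlsc : SeqWeakLSCOn (fun x : E => σ * ‖x‖ ^ 2 - P x) (closedBall 0 r))
    (M : ℝ) (hM : 0 ≤ M) (lam : ℝ) (hlam0 : 0 < lam)
    (hlam : ENNReal.ofReal lam ≤
      min (ENNReal.ofReal r /
            ((⨆ x ∈ closedBall (0 : E) r, ENNReal.ofReal ‖x + gradient P x‖) + ENNReal.ofReal M))
        (ENNReal.ofReal (1 / (2 * σ)))) :
    ∃ δ : ℝ, 0 < δ ∧
      ∀ S : Set E, S ⊆ closedBall 0 r → Convex ℝ S → closedBall 0 r ⊆ closure S →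
      ∀ γ : E → ℝ, ContDiff ℝ 1 γ →
        (⨆ x ∈ closedBall (0 : E) r, (γ x : EReal)) - (⨅ x ∈ closedBall (0 : E) r, (γ x : EReal))
          < (δ : EReal) →
        (∀ x ∈ closedBall (0 : E) r, ‖gradient γ x‖ ≤ M) →
        SeqWeakLSCOn (fun x : E => σ * ‖x‖ ^ 2 - P x - γ x) (closedBall 0 r) →
        ∃ y ∈ S, ‖y‖ < r ∧
          ∃ x₁ ∈ closedBall (0 : E) r, ∃ x₂ ∈ closedBall (0 : E) r, x₁ ≠ x₂ ∧
            x₁ = lam • (gradient P x₁ + gradient γ x₁ + y) ∧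
            x₂ = lam • (gradient P x₂ + gradient γ x₂ + y) := by
  obtain ⟨hlam1, hlam2⟩ := le_min_iff.1 hlam
  have hσlam : σ ≤ 1 / (2 * lam) := by
    have h1 : lam ≤ 1 / (2 * σ) := (ENNReal.ofReal_le_ofReal_iff (by positivity)).1 hlam2
    rw [le_div_iff₀ (by positivity)] at h1 ⊢
    linarith
  -- Passing from the coefficient `σ` to `1 / (2 * lam) ≥ σ` adds a weakly lsc term.
  have hlift : ∀ f : E → ℝ, SeqWeakLSCOn (fun x => σ * ‖x‖ ^ 2 - f x) (closedBall 0 r) →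
      SeqWeakLSCOn (fun x => 1 / (2 * lam) * ‖x‖ ^ 2 - f x) (closedBall 0 r) := by
    intro f hf
    convert hf.add (SeqWeakLSCOn.const_mul_norm_sq (sub_nonneg.2 hσlam) _) using 2 with x
    ring
  obtain ⟨m, δ, hδ, hgap, hm⟩ := exists_minimax_gap
    (J := fun x => 1 / (2 * lam) * ‖x‖ ^ 2 - P x) hr
    ((continuous_const.mul (continuous_norm.pow 2)).sub hP.continuous) (hlift P hlsc)
    (fun x => by simp only [norm_neg, hPeven x]) (by simp [hP0]) (by
      obtain ⟨x, hx, hlt⟩ := exists_mul_norm_sq_lt_of_limsup_eq_top hlimsup hr (1 / (2 * lam))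
      exact ⟨x, hx, by linarith⟩)
  refine ⟨δ, hδ, fun S hSB hSconv hSdense γ hγ hosc hγM hlscγ => ?_⟩
  obtain ⟨a, b, hab, hγab⟩ := exists_bounds_of_iSup_sub_iInf_lt (nonempty_closedBall.2 hr.le) hosc
  let Q : E → ℝ := fun x => P x + γ x
  have hQgrad : ∀ x, gradient Q x = gradient P x + gradient γ x := by
    intro x
    have h1 := (hP.differentiable one_ne_zero x).hasGradientAt.hasFDerivAt.add
      (hγ.differentiable one_ne_zero x).hasGradientAt.hasFDerivAt
    rw [← map_add] at h1
    exact (hasGradientAt_iff_hasFDerivAt.2 h1).gradient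
  have hQdiff : Differentiable ℝ Q :=
    (hP.differentiable one_ne_zero).add (hγ.differentiable one_ne_zero)
  have hJ : SeqWeakLSCOn (fun x => 1 / (2 * lam) * ‖x‖ ^ 2 - Q x) (closedBall 0 r) :=
    hlift Q (by simpa only [Q, sub_add_eq_sub_sub] using hlscγ)
  -- The perturbation `γ` raises the lower value to at most `m - a` and lowers the upper value to
  -- at least `m + δ - b`; the midpoint of the two is a strict lower bound for the latter.
  obtain ⟨y, ⟨hyS, hyr⟩, x₁, hx₁, x₂, hx₂, hne, hmin₁, hmin₂⟩ :=
    exists_two_isMinOn_sub_inner (J := fun x => 1 / (2 * lam) * ‖x‖ ^ 2 - Q x)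
      (T := S ∩ {y | ‖y‖ < r}) (R := r) (c := m - a) (c' := ((m - a) + (m + δ - b)) / 2) hr.le
      ((continuous_const.mul (continuous_norm.pow 2)).sub hQdiff.continuous) hJ
      (fun y hy => hSB hy.1)
      (hSconv.inter (by simpa [ball, dist_zero_right] using convex_ball (0 : E) r)) (by linarith)
      (fun y _ => by
        obtain ⟨x, hx, hle⟩ := hm y
        have := (hγab x hx).1
        exact ⟨x, hx, by simp only [Q]; linarith⟩)
      (fun x hx => by
        have h1 := hgap x hx
        have h2 := (hγab x hx).2
        obtain ⟨y, hyS, hyr, hlt⟩ := exists_mem_norm_lt_lt_neg_inner hr hSdense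
          (show ((m - a) + (m + δ - b)) / 2 - (1 / (2 * lam) * ‖x‖ ^ 2 - Q x) < r * ‖x‖ by
            simp only [Q]; linarith)
        exact ⟨y, ⟨hyS, hyr⟩, by linarith⟩)
  have hcrit : ∀ x ∈ closedBall (0 : E) r,
      IsMinOn (fun x => 1 / (2 * lam) * ‖x‖ ^ 2 - Q x - inner ℝ x y) (closedBall 0 r) x →
        x = lam • (gradient P x + gradient γ x + y) := by
    intro x hx hmin
    rw [← hQgrad]
    refine eq_smul_gradient_add_of_isMinOn hlam0 (hQdiff x) hx hyr ?_ hmin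
    refine le_trans (mul_le_mul_of_nonneg_left ?_ hlam0.le)
      (mul_norm_add_le_of_ofReal_le_div (g := fun x => x + gradient P x) hr.le hM hlam0.le hlam1 hx)
    rw [hQgrad, ← add_assoc]
    exact (norm_add_le _ _).trans (add_le_add_right (hγM x hx) _)
  exact ⟨y, hyS, hyr, x₁, hx₁, x₂, hx₂, hne, hcrit x₁ hx₁ hmin₁, hcrit x₂ hx₂ hmin₂⟩
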